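/- Let $S$ be a finite semigroup whose idempotents commute, and let $K$ be a field. Let $R(S)$ be the set of regular elements of $S$, i.e. those $u\in S$ for which there is $t\in S$ with $utu=u$ and $tut=t$; this $t$ is unique and is written $u^{-1}$, and $R(S)$ is a subsemigroup of $S$. Order $R(S)$ by $s\le t$ iff $s=et$ for some idempotent $e$, let $\mu$ be the Möbius function of this finite poset, and for $s\in R(S)$ put $\lfloor s\rfloor=\sum_{t\le s}\mu(t,s)\,t\in KR(S)$. For $s\in S$ let $s^{\downarrow}=\{u\in R(S)\mid uu^{-1}s=u\}$, and let $\nu:KS\to KR(S)$ be the $K$-linear map between the semigroup algebras with \[\nu(s)=\sum_{t\in s^{\downarrow}}\lfloor t\rfloor\qquad(s\in S).\] For a $K$-algebra $A$ (not necessarily with identity) let $\mathrm{Rad}(A)$ be its Jacobson radical. (1) The map $\nu$ is a homomorphism of $K$-algebras that restricts to the identity on $KR(S)\subseteq KS$, i.e. $\nu$ is a retraction, and $\ker\nu$ is nilpotent. Moreover, $\nu$ induces an isomorphism of $K$-algebras $KS/\mathrm{Rad}(KS)\cong KR(S)/\mathrm{Rad}(KR(S))$. (2) If the characteristic of $K$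 is $0$, or more generally does not divide the order of any maximal subgroup of $S$ (the group of units of $eSe$, for $e\in S$ idempotent), then $\ker\nu=\mathrm{Rad}(KS)$. In this case $\dim_K\mathrm{Rad}(KS)=|S\setminus R(S)|$, and the elements $s-\nu(s)$ with $s\in S\setminus R(S)$ form a basis of $\mathrm{Rad}(KS)$ (where $KR(S)$ is viewed inside $KS$). -/

import Mathlib

/-! ### The Jacobson radical of a ring that need not have an identity -/

section Radical

variable {A : Type*} [NonUnitalRing A]

/-- In a ring with identity, `a` belongs to the Jacobson radical iff all `1 + y * a` are units. -/
theorem mem_ringJacobson_iff_isUnit {B : Type*} [Ring B] (a : B) :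
    a ∈ Ring.jacobson B ↔ ∀ y : B, IsUnit (1 + y * a) := by
  rw [← Ideal.jacobson_bot, Ideal.mem_jacobson_iff]
  constructor
  · intro h
    have left : ∀ y : B, ∃ z, z * (1 + y * a) = 1 := by
      intro y
      obtain ⟨z, hz⟩ := h y
      rw [Ideal.mem_bot] at hz
      refine ⟨z, ?_⟩
      rw [mul_add, mul_one, ← mul_assoc, add_comm]
      exact sub_eq_zero.1 hz
    intro y
    obtain ⟨z, hz⟩ := left y
    obtain ⟨w, hw⟩ := left (-(z * y))
    have hz' : 1 + -(z * y) * a = z := by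
      have h1 : z + z * y * a = 1 := by rw [← hz]; noncomm_ring
      rw [← h1]; noncomm_ring
    rw [hz'] at hw
    have h2 : w = 1 + y * a := by
      calc w = w * (z * (1 + y * a)) := by rw [hz, mul_one]
        _ = _ := by rw [← mul_assoc, hw, one_mul]
    exact ⟨⟨1 + y * a, z, by rw [← h2]; exact hw, hz⟩, rfl⟩
  · intro h y
    obtain ⟨u, hu⟩ := h y
    refine ⟨(↑u⁻¹ : B), ?_⟩
    have h1 : (↑u⁻¹ : B) * (1 + y * a) = 1 := by rw [← hu, Units.inv_mul]
    rw [Ideal.mem_bot, ← h1]; noncomm_ring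

theorem isUnit_one_add_of_isUnit_one_sub_sq {B : Type*} [Ring B] (c : B)
    (h : IsUnit (1 + -(c * c))) : IsUnit (1 + c) := by
  obtain ⟨u, hu⟩ := h
  have h1 : (1 - c) * (1 + c) = u := by rw [hu]; noncomm_ring
  have h2 : (1 + c) * (1 - c) = u := by rw [hu]; noncomm_ring
  have h3 : (↑u⁻¹ * (1 - c)) * (1 + c) = 1 := by rw [mul_assoc, h1, Units.inv_mul]
  have h4 : (1 + c) * ((1 - c) * ↑u⁻¹) = 1 := by rw [← mul_assoc, h2, Units.mul_inv]
  have h5 := left_inv_eq_right_inv h3 h4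
  exact ⟨⟨1 + c, ↑u⁻¹ * (1 - c), by rw [h5, h4], h3⟩, rfl⟩

theorem forall_isQuasiregular_iff (R : Type*) [CommRing R] [Module R A] [IsScalarTower R A A]
    [SMulCommClass R A A] (a : A) :
    (∀ b : A, IsQuasiregular (b * a)) ↔
      (a : Unitization R A) ∈ Ring.jacobson (Unitization R A) := by
  rw [mem_ringJacobson_iff_isUnit]
  constructor
  · intro h y
    have hc : ((y.fst • a + y.snd * a : A) : Unitization R A) = y * a := by
      ext <;> simp
    set c : A := y.fst • a + y.snd * a with hcdef
    have h1 : (-(c * c) : A) = (-(c * y.snd) - y.fst • c) * a := by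
      have h3 : c * c = y.fst • (c * a) + c * y.snd * a := by
        conv_lhs => rw [show c * c = c * (y.fst • a + y.snd * a) by rw [← hcdef]]
        rw [mul_add, mul_smul_comm, mul_assoc]
      rw [h3, sub_mul, neg_mul, smul_mul_assoc]; abel
    have h2 := (isQuasiregular_iff_isUnit' R).1 (h1 ▸ h (-(c * y.snd) - y.fst • c))
    rw [← hc]
    refine isUnit_one_add_of_isUnit_one_sub_sq _ ?_
    rwa [Unitization.inr_neg, Unitization.inr_mul] at h2
  · intro h b
    rw [isQuasiregular_iff_isUnit' R, Unitization.inr_mul]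
    exact h b

/-- The Jacobson radical of a ring `A` that need not have an identity: the largest ideal all of
whose elements are quasiregular. It consists of those `a` for which every `b * a` is
quasiregular. -/
def jacobsonRadical (A : Type*) [NonUnitalRing A] : TwoSidedIdeal A :=
  TwoSidedIdeal.mk' {a : A | ∀ b : A, IsQuasiregular (b * a)}
    ((forall_isQuasiregular_iff ℤ (0 : A)).2 (by simp))
    (fun {x y} hx hy => (forall_isQuasiregular_iff ℤ (x + y)).2 (by
      rw [Unitization.inr_add]
      exact add_mem ((forall_isQuasiregular_iff ℤ x).1 hx) ((forall_isQuasiregular_iff ℤ y).1 hy)))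
    (fun {x} hx => (forall_isQuasiregular_iff ℤ (-x)).2 (by
      rw [Unitization.inr_neg]
      exact neg_mem ((forall_isQuasiregular_iff ℤ x).1 hx)))
    (fun {x y} hy => (forall_isQuasiregular_iff ℤ (x * y)).2 (by
      rw [Unitization.inr_mul]
      exact Ideal.mul_mem_left _ _ ((forall_isQuasiregular_iff ℤ y).1 hy)))
    (fun {x y} hx => (forall_isQuasiregular_iff ℤ (x * y)).2 (by
      rw [Unitization.inr_mul]
      exact Ideal.mul_mem_right _ _ ((forall_isQuasiregular_iff ℤ x).1 hx)))

theorem mem_jacobsonRadical {a : A} :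
    a ∈ jacobsonRadical A ↔ ∀ b : A, IsQuasiregular (b * a) :=
  TwoSidedIdeal.mem_mk' _ _ _ _ _ _ _

/-- The Jacobson radical of a `K`-algebra, as a `K`-subspace. -/
def jacobsonRadicalSubmodule (K A : Type*) [Field K] [NonUnitalRing A] [Module K A]
    [IsScalarTower K A A] [SMulCommClass K A A] : Submodule K A where
  carrier := {a | a ∈ jacobsonRadical A}
  zero_mem' := (jacobsonRadical A).zero_mem
  add_mem' := (jacobsonRadical A).add_mem
  smul_mem' k a ha := mem_jacobsonRadical.2 fun b => by
    have h := mem_jacobsonRadical.1 ha (k • b)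
    rwa [smul_mul_assoc, ← mul_smul_comm] at h

/-- The quotient ring `A / Rad(A)`. -/
def RadicalQuotient (A : Type*) [NonUnitalRing A] : Type _ := (jacobsonRadical A).ringCon.Quotient

namespace RadicalQuotient

noncomputable instance : NonUnitalRing (RadicalQuotient A) :=
  inferInstanceAs (NonUnitalRing (jacobsonRadical A).ringCon.Quotient)

/-- The class in `A / Rad(A)` of an element of `A`. -/
def mk (a : A) : RadicalQuotient A := (a : (jacobsonRadical A).ringCon.Quotient)

theorem mk_eq_mk {a b : A} : mk a = mk b ↔ a - b ∈ jacobsonRadical A := by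
  rw [← TwoSidedIdeal.rel_iff]
  exact (jacobsonRadical A).ringCon.eq

theorem mk_surjective : Function.Surjective (mk : A → RadicalQuotient A) :=
  Quotient.mk_surjective

variable {K : Type*} [Field K] [Module K A] [IsScalarTower K A A] [SMulCommClass K A A]

/-- Scalars act on `A / Rad(A)` through representatives. -/
instance : SMul K (RadicalQuotient A) where
  smul k := Quotient.map (k • ·) fun a b h => by
    have h' : a - b ∈ jacobsonRadical A := (TwoSidedIdeal.rel_iff _ _ _).1 h
    refine (TwoSidedIdeal.rel_iff _ _ _).2 ?_
    rw [← smul_sub]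
    exact (jacobsonRadicalSubmodule K A).smul_mem k h'

noncomputable instance : Module K (RadicalQuotient A) :=
  Function.Surjective.module K
    { toFun := mk, map_zero' := rfl, map_add' := fun _ _ => rfl } mk_surjective fun _ _ => rfl

end RadicalQuotient

/-- A set `I` (in practice an ideal) is nilpotent: for some `n`, every product
`a * l₁ * ⋯ * lₙ` of `n + 1` elements of `I` vanishes. -/
def IsNilpotentSet (I : Set A) : Prop :=
  ∃ n : ℕ, ∀ a ∈ I, ∀ l : List A, l.length = n → (∀ x ∈ l, x ∈ I) → l.foldl (· * ·) a = 0

end Radical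

/-! ### Semigroups with commuting idempotents -/

/-- Any two idempotents commute. -/
class CommutingIdempotents (S : Type*) [Semigroup S] : Prop where
  comm : ∀ e f : S, IsIdempotentElem e → IsIdempotentElem f → e * f = f * e

/-- `s` and `t` are inverses of each other. -/
def AreInverses {S : Type*} [Semigroup S] (s t : S) : Prop :=
  s * t * s = s ∧ t * s * t = t

/-- The maximal subgroup at an idempotent `e`: the group of units of the monoid `eSe`. -/
def maximalSubgroup {S : Type*} [Semigroup S] (e : S) : Set S :=
  {s | (e * s = s ∧ s * e = s) ∧ ∃ t : S, (e * t = t ∧ t * e = t) ∧ s * t = e ∧ t * s = e}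

section Regular

variable {S : Type*} [Semigroup S]

theorem AreInverses.symm {s t : S} (h : AreInverses s t) : AreInverses t s := ⟨h.2, h.1⟩

theorem AreInverses.idem {s t : S} (h : AreInverses s t) : IsIdempotentElem (s * t) := by
  rw [IsIdempotentElem, ← mul_assoc, h.1]

variable [CommutingIdempotents S]

theorem AreInverses.mul {a a' b b' : S} (ha : AreInverses a a') (hb : AreInverses b b') :
    AreInverses (a * b) (b' * a') := by
  have aux : ∀ {a a' b b' : S}, AreInverses a a' → AreInverses b b' →
      a * b * (b' * a') * (a * b) = a * b := by
    intro a a' b b' ha hb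
    have hc := CommutingIdempotents.comm _ _ hb.idem ha.symm.idem
    calc a * b * (b' * a') * (a * b) = a * ((b * b') * (a' * a)) * b := by simp only [mul_assoc]
      _ = (a * a' * a) * (b * b' * b) := by rw [hc]; simp only [mul_assoc]
      _ = a * b := by rw [ha.1, hb.1]
  exact ⟨aux ha hb, aux hb.symm ha.symm⟩

theorem AreInverses.unique {s t t' : S} (h : AreInverses s t) (h' : AreInverses s t') :
    t = t' := by
  have h1 := CommutingIdempotents.comm _ _ h.symm.idem h'.symm.idem
  have h2 := CommutingIdempotents.comm _ _ h.idem h'.idem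
  have e1 : t = t' * s * t := by
    calc t = t * (s * t' * s) * t := by rw [h'.1, h.2]
      _ = (t * s) * (t' * s) * t := by simp only [mul_assoc]
      _ = t' * (s * t * s) * t := by rw [h1]; simp only [mul_assoc]
      _ = _ := by rw [h.1]
  have e2 : t' = t' * s * t := by
    calc t' = t' * (s * t * s) * t' := by rw [h.1, h'.2]
      _ = t' * ((s * t) * (s * t')) := by simp only [mul_assoc]
      _ = (t' * s * t') * s * t := by rw [h2]; simp only [mul_assoc]
      _ = _ := by rw [h'.2]
  rw [e1, ← e2]

variable (S) in
/-- `R(S)`: the subsemigroup of regular elements. -/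
def regularElements : Subsemigroup S where
  carrier := {s | ∃ t, AreInverses s t}
  mul_mem' := fun ⟨_, ha⟩ ⟨_, hb⟩ => ⟨_, ha.mul hb⟩

namespace regularElements

/-- The inverse `u⁻¹` of a regular element. -/
noncomputable def inv (u : regularElements S) : regularElements S :=
  ⟨u.2.choose, u, u.2.choose_spec.symm⟩

theorem areInverses_inv (u : regularElements S) : AreInverses u (inv u) := by
  have h : AreInverses (u : S) (inv u : S) := u.2.choose_spec
  exact ⟨Subtype.ext h.1, Subtype.ext h.2⟩

theorem idem_coe {e : regularElements S} (he : IsIdempotentElem e) :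
    IsIdempotentElem (e : S) := congrArg Subtype.val he

theorem comm {e f : regularElements S} (he : IsIdempotentElem e) (hf : IsIdempotentElem f) :
    e * f = f * e :=
  Subtype.ext (CommutingIdempotents.comm _ _ (idem_coe he) (idem_coe hf))

/-- The natural partial order on `R(S)`: `s ≤ t` iff `s = e t` for some idempotent `e`. -/
instance : PartialOrder (regularElements S) where
  le s t := ∃ e : regularElements S, IsIdempotentElem e ∧ s = e * t
  le_refl s := ⟨s * inv s, (areInverses_inv s).idem, (areInverses_inv s).1.symm⟩
  le_trans := by
    rintro s t r ⟨e, he, rfl⟩ ⟨f, hf, rfl⟩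
    refine ⟨e * f, ?_, (mul_assoc _ _ _).symm⟩
    calc e * f * (e * f) = e * (f * e) * f := by simp only [mul_assoc]
      _ = (e * e) * (f * f) := by rw [comm hf he]; simp only [mul_assoc]
      _ = e * f := by rw [he, hf]
  le_antisymm := by
    rintro s t ⟨e, he, hs⟩ ⟨f, hf, ht⟩
    have hes : e * s = s := by rw [hs, ← mul_assoc, he]
    calc s = e * (f * s) := by rw [← ht, hs]
      _ = f * (e * s) := by rw [← mul_assoc, comm he hf, mul_assoc]
      _ = t := by rw [hes, ← ht]

theorem le_def {s t : regularElements S} :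
    s ≤ t ↔ ∃ e : regularElements S, IsIdempotentElem e ∧ s = e * t := Iff.rfl

open Classical in
noncomputable instance [Finite S] : LocallyFiniteOrder (regularElements S) :=
  haveI := Fintype.ofFinite (regularElements S)
  Fintype.toLocallyFiniteOrder

end regularElements

open scoped MonoidAlgebra

variable (K : Type*) [Field K]

variable (S) in
/-- The inclusion of `K R(S)` in `K S` as a subalgebra. -/
noncomputable def inclusion : K[regularElements S] →ₙₐ[K] K[S] :=
  MonoidAlgebra.mapDomainNonUnitalAlgHom K K (MulMemClass.subtype (regularElements S))

/-- `s↓`: the set of `u ∈ R(S)` with `u u⁻¹ s = u`. -/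
def downSet (s : S) : Set (regularElements S) :=
  {u | (u : S) * (regularElements.inv u : S) * s = u}

variable [Finite S]

/-- The groupoid basis element `⌊s⌋ = ∑_{t ≤ s} μ(t, s) t` of `K R(S)`, where `μ` is the
(integer-valued) Möbius function of the natural partial order on `R(S)`. -/
noncomputable def groupoidBasisElement (s : regularElements S) : K[regularElements S] :=
  open Classical in
  ∑ t ∈ (Set.toFinite (Set.Iic s)).toFinset,
    MonoidAlgebra.single t ((IncidenceAlgebra.mu ℤ t s : ℤ) : K)

variable (S) in
/-- The linear map `ν : K S → K R(S)` with `ν(s) = ∑_{t ∈ s↓} ⌊t⌋` for `s ∈ S`. -/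
noncomputable def nu : K[S] →ₗ[K] K[regularElements S] :=
  (Finsupp.linearCombination K fun s : S =>
      ∑ t ∈ (Set.toFinite (downSet s)).toFinset, groupoidBasisElement K t) ∘ₗ
    (MonoidAlgebra.coeffLinearEquiv K : K[S] ≃ₗ[K] (S →₀ K)).toLinearMap

end Regular

/-! The elements `⌊s⌋` form a basis of `K R(S)`, and it multiplies like a groupoid: `⌊s⌋⌊t⌋` is
`⌊st⌋` if `s⁻¹s = tt⁻¹`, and `0` otherwise. This and the multiplicativity of `ν` both come from
`sum_downSet_mul`: `(u, v) ↦ uv` is a bijection from the composable pairs in `s↓ × t↓` onto `(st)↓`.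
On regular `s`, `s↓` is the principal lower set, so Möbius inversion makes `ν` a retraction.

Every `x ∈ ker ν` is nilpotent because squaring shrinks the principal ideals generated by its
support. If some product `ab` generated one of maximal size, then `a` would be regular
(`mem_regularElements_of_ncard_le`), but `ν(x) = 0` excludes regular elements of maximal ideal size
from the support (`coeff_eq_zero_of_nu_eq_zero`). A nil ideal of a finite-dimensional algebra lies
in the nilpotent radical, and a surjection with nil kernel identifies the quotients by the radicals.

For (2), `domainTrace` vanishes on nilpotent elements, and `domainTrace_inv_mul` is an orthogonality
relation whose diagonal values are orders of maximal subgroups. If these are nonzero in `K`, then `K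
R(S)` has zero radical. -/

open scoped MonoidAlgebra

/-! ### Inverses, lower sets and composable pairs. -/

namespace regularElements

variable {S : Type*} [Semigroup S] [CommutingIdempotents S]

instance : CommutingIdempotents (regularElements S) := ⟨fun _ _ => comm⟩

theorem mul_inv_mul (u : regularElements S) : u * inv u * u = u := (areInverses_inv u).1

theorem inv_mul_inv (u : regularElements S) : inv u * u * inv u = inv u := (areInverses_inv u).2

theorem inv_eq {u t : regularElements S} (h : AreInverses u t) : inv u = t :=
  (areInverses_inv u).unique h

theorem inv_mul (u v : regularElements S) : inv (u * v) = inv v * inv u :=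
  inv_eq ((areInverses_inv u).mul (areInverses_inv v))

protected theorem inv_inv (u : regularElements S) : inv (inv u) = u :=
  inv_eq (areInverses_inv u).symm

theorem idem_mul_inv (u : regularElements S) : IsIdempotentElem (u * inv u) :=
  (areInverses_inv u).idem

theorem idem_inv_mul (u : regularElements S) : IsIdempotentElem (inv u * u) :=
  (areInverses_inv u).symm.idem

theorem inv_idem {e : regularElements S} (he : IsIdempotentElem e) : inv e = e :=
  inv_eq ⟨by rw [he, he], by rw [he, he]⟩

theorem mem_downSet {u : regularElements S} {s : S} :
    u ∈ downSet s ↔ ((u * inv u : regularElements S) : S) * s = u := Iff.rfl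

theorem mem_downSet_coe {u s : regularElements S} : u ∈ downSet (s : S) ↔ u ≤ s := by
  rw [mem_downSet, ← MulMemClass.coe_mul, Subtype.coe_inj, le_def]
  constructor
  · intro h
    exact ⟨_, idem_mul_inv u, h.symm⟩
  · rintro ⟨e, he, rfl⟩
    rw [inv_mul, inv_idem he]
    calc e * s * (inv s * e) * s = e * ((s * inv s) * e) * s := by simp only [mul_assoc]
      _ = (e * e) * (s * inv s * s) := by
        rw [comm (idem_mul_inv s) he]; simp only [mul_assoc]
      _ = e * s := by rw [he, mul_inv_mul]

theorem downSet_coe (s : regularElements S) : downSet (s : S) = Set.Iic s :=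
  Set.ext fun _ => mem_downSet_coe

/-- If `u` and `v` are composable in the underlying groupoid, `u * v` has the range of `u`. -/
theorem mul_mul_inv_of_composable {u v : regularElements S} (h : inv u * u = v * inv v) :
    u * v * inv (u * v) = u * inv u := by
  calc u * v * inv (u * v) = u * (v * inv v) * inv u := by rw [inv_mul]; simp only [mul_assoc]
    _ = (u * inv u * u) * inv u := by rw [← h]; simp only [mul_assoc]
    _ = u * inv u := by rw [mul_inv_mul]

theorem inv_mul_mul_of_composable {u v : regularElements S} (h : inv u * u = v * inv v) :
    inv (u * v) * (u * v) = inv v * v := by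
  calc inv (u * v) * (u * v) = inv v * (inv u * u) * v := by
        rw [inv_mul]; simp only [mul_assoc]
    _ = (inv v * v * inv v) * v := by rw [h]; simp only [mul_assoc]
    _ = inv v * v := by rw [inv_mul_inv]

/-- Since `uv` has range idempotent `uu⁻¹`, the claim is `uu⁻¹st = ut = u(u⁻¹u)t = u(vv⁻¹)t = uv`.
-/
theorem mul_mem_downSet {s t : S} {u v : regularElements S} (hu : u ∈ downSet s)
    (hv : v ∈ downSet t) (h : inv u * u = v * inv v) : u * v ∈ downSet (s * t) := by
  rw [mem_downSet] at *
  rw [mul_mul_inv_of_composable h, ← mul_assoc, hu]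
  nth_rewrite 1 [← mul_inv_mul u]
  rw [mul_assoc u, h, MulMemClass.coe_mul, mul_assoc, hv, MulMemClass.coe_mul]

/-- An element with a right factor recovering an idempotent `e` fixing it is regular, with range
idempotent `e`. -/
theorem exists_regular_of_mul_eq {e : regularElements S} (he : IsIdempotentElem e) {a x : S}
    (hea : (e : S) * a = a) (hax : a * x = e) :
    ∃ u : regularElements S, (u : S) = a ∧ u * inv u = e := by
  have h1 : a * x * a = a := by rw [hax, hea]
  let u : regularElements S := ⟨a, x * a * x, by
    constructor
    · calc a * (x * a * x) * a = (a * x * a) * x * a := by simp only [mul_assoc]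
        _ = a := by rw [h1, h1]
    · calc x * a * x * a * (x * a * x) = x * ((a * x * a) * x * a) * x := by simp only [mul_assoc]
        _ = x * a * x := by rw [h1, h1]⟩
  refine ⟨u, rfl, ?_⟩
  have hu : (u : S) = a := rfl
  have h2 : e * (u * inv u) = u * inv u := by
    apply Subtype.ext
    simp only [MulMemClass.coe_mul, hu, ← mul_assoc, hea]
  have h3 : u * inv u * e = e := by
    apply Subtype.ext
    have h4 : (u : S) * inv u * u = u := congrArg Subtype.val (mul_inv_mul u)
    rw [MulMemClass.coe_mul, MulMemClass.coe_mul, ← hax, ← mul_assoc, ← hu, h4]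
  rw [← h2, comm he (idem_mul_inv u), h3]

/-- The factorization is forced: with `e = ww⁻¹`, take `u = es` and `v = u⁻¹w`. That `es` is
regular, although `s` need not be, follows from `es · tw⁻¹ = e`. -/
theorem exists_mul_of_mem_downSet {s t : S} {w : regularElements S} (hw : w ∈ downSet (s * t)) :
    ∃ u ∈ downSet s, ∃ v ∈ downSet t, inv u * u = v * inv v ∧ u * v = w := by
  rw [mem_downSet] at hw
  obtain ⟨e, he_def⟩ : ∃ e, e = w * inv w := ⟨_, rfl⟩
  have he : IsIdempotentElem e := he_def ▸ idem_mul_inv w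
  rw [← he_def] at hw
  have hax : (e : S) * s * (t * inv w) = e := by
    calc (e : S) * s * (t * inv w) = (e * (s * t)) * inv w := by simp only [mul_assoc]
      _ = e := by rw [hw, he_def, MulMemClass.coe_mul]
  obtain ⟨u, hu, hue⟩ := exists_regular_of_mul_eq he (a := e * s)
    (by rw [← mul_assoc, idem_coe he]) hax
  have hvv : inv u * w * inv (inv u * w) = inv u * u := by
    calc inv u * w * inv (inv u * w) = inv u * e * u := by
          rw [inv_mul, regularElements.inv_inv, he_def]; simp only [mul_assoc]
      _ = inv u * u := by
          rw [← hue, mul_assoc, mul_inv_mul]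
  refine ⟨u, ?_, inv u * w, ?_, hvv.symm, ?_⟩
  · rw [mem_downSet, hue, hu]
  · rw [mem_downSet, hvv, MulMemClass.coe_mul, hu, MulMemClass.coe_mul, mul_assoc, mul_assoc, hw]
  · rw [← mul_assoc, hue, he_def, mul_inv_mul]

variable [Finite S]

open Classical in
theorem sum_downSet_mul {M : Type*} [AddCommMonoid M] (s t : S) (h : regularElements S → M) :
    ∑ w ∈ (Set.toFinite (downSet (s * t))).toFinset, h w =
      ∑ u ∈ (Set.toFinite (downSet s)).toFinset, ∑ v ∈ (Set.toFinite (downSet t)).toFinset,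
        if inv u * u = v * inv v then h (u * v) else 0 := by
  rw [← Finset.sum_product', ← Finset.sum_filter]
  symm
  refine Finset.sum_bij (fun p _ => p.1 * p.2) ?_ ?_ ?_ fun _ _ => rfl
  · rintro ⟨u, v⟩ hp
    simp only [Finset.mem_filter, Finset.mem_product, Set.Finite.mem_toFinset] at hp ⊢
    exact mul_mem_downSet hp.1.1 hp.1.2 hp.2
  · rintro ⟨u, v⟩ hp ⟨u', v'⟩ hp' heq
    simp only [Finset.mem_filter, Finset.mem_product, Set.Finite.mem_toFinset] at hp hp' heq
    -- Injectivity: the product determines the range idempotent of `u`, hence `u = uu⁻¹s`, and then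
    -- `v = u⁻¹(uv)`.
    have h1 : u * inv u = u' * inv u' := by
      rw [← mul_mul_inv_of_composable hp.2, heq, mul_mul_inv_of_composable hp'.2]
    obtain rfl : u = u' := by
      apply Subtype.ext
      rw [← mem_downSet.1 hp.1.1, h1, mem_downSet.1 hp'.1.1]
    have h2 : v = v' := by
      rw [← mul_inv_mul v, ← hp.2, mul_assoc, heq, ← mul_assoc, hp'.2, mul_inv_mul]
    rw [h2]
  · intro w hw
    rw [Set.Finite.mem_toFinset] at hw
    obtain ⟨u, hu, v, hv, huv, rfl⟩ := exists_mul_of_mem_downSet hw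
    exact ⟨(u, v), by simp [hu, hv, huv], rfl⟩

end regularElements

/-! ### Uniqueness in Möbius inversion. -/

section MoebiusUniqueness

/-- On a finite poset, a function is determined by its sums over the principal lower sets. -/
theorem eq_of_sum_Iic_eq {P M : Type*} [PartialOrder P] [Finite P] [AddCommGroup M] {F G : P → M}
    (h : ∀ p, ∑ q ∈ (Set.toFinite (Set.Iic p)).toFinset, F q =
      ∑ q ∈ (Set.toFinite (Set.Iic p)).toFinset, G q) (p : P) : F p = G p := by
  classical
  induction p using WellFoundedLT.induction with
  | ind p ih =>
    have hp : p ∈ (Set.toFinite (Set.Iic p)).toFinset := by simp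
    have h1 := h p
    rw [← Finset.add_sum_erase _ _ hp, ← Finset.add_sum_erase _ _ hp,
      Finset.sum_congr rfl fun q hq => ih q ?_] at h1
    · exact add_right_cancel h1
    · simp only [Finset.mem_erase, Set.Finite.mem_toFinset, Set.mem_Iic] at hq
      exact lt_of_le_of_ne hq.2 hq.1

end MoebiusUniqueness

open regularElements

/-! ### The groupoid basis and the homomorphism `ν`. -/

section Groupoid

variable {S : Type*} [Semigroup S] [CommutingIdempotents S] [Finite S] (K : Type*) [Field K]

/-- Möbius inversion: after exchanging the sums, the coefficient of `r` is the sum of `μ(r, t)` over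
`t ∈ [r, s]`, which is `1` for `r = s` and `0` otherwise. -/
theorem sum_groupoidBasisElement (s : regularElements S) :
    ∑ t ∈ (Set.toFinite (Set.Iic s)).toFinset, groupoidBasisElement K t =
      MonoidAlgebra.single s 1 := by
  classical
  unfold groupoidBasisElement
  rw [Finset.sum_comm' (t' := (Set.toFinite (Set.Iic s)).toFinset)
    (s' := fun r => Finset.Icc r s)]
  · have key : ∀ r : regularElements S, ∑ t ∈ Finset.Icc r s,
        (MonoidAlgebra.single r ((IncidenceAlgebra.mu ℤ r t : ℤ) : K) : K[regularElements S]) =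
          if r = s then MonoidAlgebra.single s 1 else 0 := by
      intro r
      have h1 := map_sum (MonoidAlgebra.singleAddHom (R := K) r)
        (fun t => ((IncidenceAlgebra.mu ℤ r t : ℤ) : K)) (Finset.Icc r s)
      have h2 := IncidenceAlgebra.sum_Icc_mu_right (𝕜 := ℤ) r s
      refine Eq.trans h1.symm ?_
      rw [← Int.cast_sum]
      have h3 : ∑ t ∈ Finset.Icc r s, IncidenceAlgebra.mu ℤ r t = if r = s then 1 else 0 := by
        convert h2
      rw [h3]
      split_ifs with h
      · subst h; simp
      · simp
    simp only [key]
    rw [Finset.sum_ite_eq' _ s]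
    simp
  · intro t r
    simp only [Set.Finite.mem_toFinset, Set.mem_Iic, Finset.mem_Icc]
    exact ⟨fun h => ⟨⟨h.2, h.1⟩, h.2.trans h.1⟩, fun h => ⟨h.1.2, h.1.1⟩⟩

open Classical in
-- By Möbius uniqueness on `R(S) × R(S)` it suffices to sum both sides over the pairs below `(s,
-- t)`. The left side gives the product `st`, and so does the right by `sum_downSet_mul`.
theorem groupoidBasisElement_mul (s t : regularElements S) :
    groupoidBasisElement K s * groupoidBasisElement K t =
      if inv s * s = t * inv t then groupoidBasisElement K (s * t) else 0 := by
  refine eq_of_sum_Iic_eq (P := regularElements S × regularElements S)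
    (F := fun p => groupoidBasisElement K p.1 * groupoidBasisElement K p.2)
    (G := fun p => if inv p.1 * p.1 = p.2 * inv p.2 then
      groupoidBasisElement K (p.1 * p.2) else 0) (fun p => ?_) (s, t)
  obtain ⟨s, t⟩ := p
  have hprod : (Set.toFinite (Set.Iic (s, t))).toFinset =
      (Set.toFinite (Set.Iic s)).toFinset ×ˢ (Set.toFinite (Set.Iic t)).toFinset := by
    ext ⟨a, b⟩; simp
  rw [hprod, Finset.sum_product, Finset.sum_product, ← Finset.sum_mul_sum]
  have h := sum_downSet_mul (s : S) t (groupoidBasisElement K)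
  simp only [← MulMemClass.coe_mul, downSet_coe, sum_groupoidBasisElement] at h
  rw [sum_groupoidBasisElement, sum_groupoidBasisElement, MonoidAlgebra.single_mul_single,
    one_mul, h]

theorem nu_single (s : S) (k : K) : nu S K (MonoidAlgebra.single s k) =
    k • ∑ t ∈ (Set.toFinite (downSet s)).toFinset, groupoidBasisElement K t := by
  simp [nu]

theorem nu_mul (x y : K[S]) : nu S K (x * y) = nu S K x * nu S K y := by
  classical
  induction x using MonoidAlgebra.induction_linear with
  | zero => simp
  | add x₁ x₂ h₁ h₂ => rw [add_mul, map_add, h₁, h₂, map_add, add_mul]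
  | single s a =>
    induction y using MonoidAlgebra.induction_linear with
    | zero => simp
    | add y₁ y₂ h₁ h₂ => rw [mul_add, map_add, h₁, h₂, map_add, mul_add]
    | single t b =>
      rw [MonoidAlgebra.single_mul_single, nu_single, nu_single, nu_single, sum_downSet_mul,
        smul_mul_smul_comm, Finset.sum_mul_sum]
      simp only [groupoidBasisElement_mul]

omit [Finite S] in
theorem inclusion_single (s : regularElements S) (k : K) :
    inclusion S K (MonoidAlgebra.single s k) = MonoidAlgebra.single (s : S) k := by
  simp [inclusion]

theorem nu_inclusion (x : K[regularElements S]) : nu S K (inclusion S K x) = x := by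
  induction x using MonoidAlgebra.induction_linear with
  | zero => simp
  | add x₁ x₂ h₁ h₂ => rw [map_add, map_add, h₁, h₂]
  | single s a =>
    rw [inclusion_single, nu_single, downSet_coe, sum_groupoidBasisElement]
    simp

variable (S) in
/-- `ν` as a homomorphism of algebras. -/
noncomputable def nuHom : K[S] →ₙₐ[K] K[regularElements S] :=
  { nu S K with
    map_zero' := map_zero (nu S K)
    map_mul' := nu_mul K }

end Groupoid

/-! ### The radical of a finite-dimensional algebra, via its unitization. -/

section FiniteDimensionalRadical

variable (K : Type*) [Field K] {A : Type*} [NonUnitalRing A] [Module K A]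
  [IsScalarTower K A A] [SMulCommClass K A A]

theorem isQuasiregular_of_isNilpotent_inr {a : A} (h : IsNilpotent (a : Unitization K A)) :
    IsQuasiregular a :=
  (isQuasiregular_iff_isUnit' K).2 h.isUnit_one_add

theorem mem_jacobsonRadical_iff_inr_mem {a : A} :
    a ∈ jacobsonRadical A ↔ (a : Unitization K A) ∈ Ring.jacobson (Unitization K A) :=
  mem_jacobsonRadical.trans (forall_isQuasiregular_iff K a)

variable [FiniteDimensional K A]

instance : IsArtinianRing (Unitization K A) :=
  haveI : Module.Finite K (Unitization K A) :=
    Module.Finite.equiv (Unitization.linearEquiv K K A).symm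
  IsArtinianRing.of_finite K _

variable (A) in
theorem isNilpotent_jacobson_unitization :
    IsNilpotent (Ring.jacobson (Unitization K A)) :=
  IsSemiprimaryRing.isNilpotent

theorem isNilpotent_inr_of_mem_jacobsonRadical {a : A} (ha : a ∈ jacobsonRadical A) :
    IsNilpotent (a : Unitization K A) := by
  obtain ⟨n, hn⟩ := isNilpotent_jacobson_unitization K A
  refine ⟨n, ?_⟩
  have h := Ideal.pow_mem_pow ((mem_jacobsonRadical_iff_inr_mem K).1 ha) n
  rwa [hn] at h

/-- The radical of a finite-dimensional algebra consists of those `a` for which every `b * a` is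
nilpotent. -/
theorem mem_jacobsonRadical_iff_isNilpotent {a : A} :
    a ∈ jacobsonRadical A ↔ ∀ b : A, IsNilpotent ((b * a : A) : Unitization K A) :=
  ⟨fun h b => isNilpotent_inr_of_mem_jacobsonRadical K ((jacobsonRadical A).mul_mem_left b a h),
    fun h => mem_jacobsonRadical.2 fun b => isQuasiregular_of_isNilpotent_inr K (h b)⟩

end FiniteDimensionalRadical

theorem isNilpotentSet_of_subset_jacobsonRadical (K : Type*) [Field K] {A : Type*}
    [NonUnitalRing A] [Module K A] [IsScalarTower K A A] [SMulCommClass K A A]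
    [FiniteDimensional K A] {I : Set A}
    (hI : ∀ a ∈ I, a ∈ jacobsonRadical A) : IsNilpotentSet I := by
  obtain ⟨n, hn⟩ := isNilpotent_jacobson_unitization K A
  refine ⟨n, fun a ha l hl hmem => ?_⟩
  -- The exponent `k` records how many radical factors the accumulator of the fold already contains.
  have key : ∀ (l : List A) (k : ℕ) (a : A), (∀ x ∈ l, x ∈ I) →
      (a : Unitization K A) ∈ Ring.jacobson (Unitization K A) ^ k →
      ((l.foldl (· * ·) a : A) : Unitization K A) ∈
        Ring.jacobson (Unitization K A) ^ (k + l.length) := by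
    intro l
    induction l with
    | nil => intro k a _ ha; simpa using ha
    | cons x l ih =>
      intro k a hl ha
      have hx := (mem_jacobsonRadical_iff_inr_mem K).1 (hI x (hl x (by simp)))
      have h := ih (k + 1) (a * x) (fun y hy => hl y (by simp [hy])) (by
        rw [Unitization.inr_mul, Submodule.pow_succ]
        exact Ideal.mul_mem_mul ha hx)
      rw [List.foldl_cons, List.length_cons, add_comm l.length 1, ← add_assoc]
      exact h
  have h := key l 0 a hmem (by rw [Submodule.pow_zero, Ideal.one_eq_top]; trivial)
  rw [zero_add, hl, hn] at h
  exact Unitization.inr_injective (R := K) (h.trans (Unitization.inr_zero K).symm)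

/-! ### Radicals along surjections with nil kernel. -/

section NilpotentTransfer

variable {K : Type*} [Field K] {A B : Type*} [NonUnitalRing A] [Module K A]
  [IsScalarTower K A A] [SMulCommClass K A A] [NonUnitalRing B] [Module K B]
  [IsScalarTower K B B] [SMulCommClass K B B]

theorem isNilpotent_map_of_isNilpotent_inr {C : Type*} [Ring C] [Algebra K C] (f : A →ₙₐ[K] C)
    {a : A} (h : IsNilpotent (a : Unitization K A)) : IsNilpotent (f a) := by
  have h1 := h.map (Unitization.lift f)
  simpa using h1

theorem isNilpotent_inr_map (f : A →ₙₐ[K] B) {a : A} (h : IsNilpotent (a : Unitization K A)) :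
    IsNilpotent (f a : Unitization K B) :=
  isNilpotent_map_of_isNilpotent_inr ((Unitization.inrNonUnitalAlgHom K B).comp f) h

/-- Nilpotency lifts along a homomorphism whose kernel consists of nilpotent elements. -/
theorem isNilpotent_inr_of_map (f : A →ₙₐ[K] B)
    (hf : ∀ x, f x = 0 → IsNilpotent (x : Unitization K A)) {a : A}
    (h : IsNilpotent (f a : Unitization K B)) : IsNilpotent (a : Unitization K A) := by
  obtain ⟨n, hn⟩ := h
  -- Only positive powers are guaranteed to stay in `A`, where `f` is defined; hence the exponent `m
  -- + 1`.
  have key : ∀ m : ℕ, ∃ c : A, (a : Unitization K A) ^ (m + 1) = c ∧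
      (f a : Unitization K B) ^ (m + 1) = f c := by
    intro m
    induction m with
    | zero => exact ⟨a, by simp, by simp⟩
    | succ m ih =>
      obtain ⟨c, h1, h2⟩ := ih
      exact ⟨c * a, by rw [pow_succ, h1, Unitization.inr_mul],
        by rw [pow_succ, h2, map_mul, Unitization.inr_mul]⟩
  obtain ⟨c, h1, h2⟩ := key n
  have hc : f c = 0 := by
    apply Unitization.inr_injective (R := K)
    rw [← h2, pow_succ, hn, zero_mul, Unitization.inr_zero]
  rw [← IsNilpotent.pow_iff_pos (n := n + 1) (by omega), h1]
  exact hf c hc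

variable [FiniteDimensional K A] [FiniteDimensional K B]

/-- Membership means that all left multiples are nilpotent; `f` preserves and reflects nilpotency,
and by surjectivity every left multiple of `f a` is the image of one of `a`. -/
theorem mem_jacobsonRadical_iff_map_mem (f : A →ₙₐ[K] B) (hs : Function.Surjective f)
    (hf : ∀ x, f x = 0 → IsNilpotent (x : Unitization K A)) {a : A} :
    a ∈ jacobsonRadical A ↔ f a ∈ jacobsonRadical B := by
  rw [mem_jacobsonRadical_iff_isNilpotent K, mem_jacobsonRadical_iff_isNilpotent K, hs.forall]
  refine forall_congr' fun b => ?_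
  rw [← map_mul]
  exact ⟨isNilpotent_inr_map f, isNilpotent_inr_of_map f hf⟩

/-- A surjective homomorphism with nil kernel induces an isomorphism of the quotients by the
radicals. -/
theorem exists_radicalQuotient_bijective (f : A →ₙₐ[K] B) (hs : Function.Surjective f)
    (hf : ∀ x, f x = 0 → IsNilpotent (x : Unitization K A)) :
    ∃ φ : RadicalQuotient A →ₙₐ[K] RadicalQuotient B, Function.Bijective φ ∧
      ∀ x, φ (RadicalQuotient.mk x) = RadicalQuotient.mk (f x) := by
  have hmk : ∀ x y : A, RadicalQuotient.mk x = RadicalQuotient.mk y ↔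
      RadicalQuotient.mk (f x) = RadicalQuotient.mk (f y) := fun x y => by
    rw [RadicalQuotient.mk_eq_mk, RadicalQuotient.mk_eq_mk, ← map_sub,
      mem_jacobsonRadical_iff_map_mem f hs hf]
  let g : RadicalQuotient A → RadicalQuotient B := fun q =>
    RadicalQuotient.mk (f (Function.surjInv RadicalQuotient.mk_surjective q))
  have hg : ∀ x, g (RadicalQuotient.mk x) = RadicalQuotient.mk (f x) := fun x =>
    (hmk _ _).1 (Function.surjInv_eq RadicalQuotient.mk_surjective _)
  refine ⟨{ toFun := g, map_smul' := ?_, map_zero' := ?_, map_add' := ?_, map_mul' := ?_ },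
    ⟨?_, ?_⟩, hg⟩
  · intro k q
    obtain ⟨x, rfl⟩ := RadicalQuotient.mk_surjective q
    have h := hg (k • x)
    rw [map_smul] at h
    rw [hg]
    exact h
  · have h := hg 0
    rw [map_zero] at h
    exact h
  · intro p q
    obtain ⟨x, rfl⟩ := RadicalQuotient.mk_surjective p
    obtain ⟨y, rfl⟩ := RadicalQuotient.mk_surjective q
    have h := hg (x + y)
    rw [map_add] at h
    rw [hg, hg]
    exact h
  · intro p q
    obtain ⟨x, rfl⟩ := RadicalQuotient.mk_surjective p
    obtain ⟨y, rfl⟩ := RadicalQuotient.mk_surjective q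
    have h := hg (x * y)
    rw [map_mul] at h
    rw [hg, hg]
    exact h
  · intro p q h
    obtain ⟨x, rfl⟩ := RadicalQuotient.mk_surjective p
    obtain ⟨y, rfl⟩ := RadicalQuotient.mk_surjective q
    replace h : g (RadicalQuotient.mk x) = g (RadicalQuotient.mk y) := h
    rw [hg, hg] at h
    exact (hmk x y).2 h
  · intro q
    obtain ⟨y, rfl⟩ := RadicalQuotient.mk_surjective q
    obtain ⟨x, rfl⟩ := hs y
    exact ⟨RadicalQuotient.mk x, hg x⟩

end NilpotentTransfer

/-! ### Idempotent powers in finite monoids. -/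

section FiniteSemigroup

/-- In a finite semigroup every element has a positive idempotent power. -/
theorem exists_isIdempotentElem_pow {M : Type*} [Monoid M] [Finite M] (x : M) :
    ∃ n : ℕ, IsIdempotentElem (x ^ (n + 1)) := by
  obtain ⟨i, j, hij, h⟩ := Finite.exists_ne_map_eq_of_infinite (fun n : ℕ => x ^ n)
  wlog hlt : i < j generalizing i j
  · exact this j i hij.symm h.symm (by omega)
  obtain ⟨p, rfl⟩ := Nat.exists_eq_add_of_lt hlt
  replace h : x ^ i = x ^ (i + (p + 1)) := h
  have hper : ∀ a k : ℕ, x ^ (i + a) = x ^ (i + a + k * (p + 1)) := by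
    intro a k
    induction k with
    | zero => simp
    | succ k ih =>
      rw [ih, show i + a + k * (p + 1) = i + (a + k * (p + 1)) by ring, pow_add, h, ← pow_add]
      congr 1; ring
  -- The powers of `x` repeat with period `p + 1` from exponent `i` on, so any positive multiple of
  -- `p + 1` that is at least `i` works; the `- 1` offsets the `n + 1` of the statement.
  refine ⟨(i + 1) * (p + 1) - 1, ?_⟩
  have h1 : (i + 1) * (p + 1) - 1 + 1 = i + (i * p + p + 1) := by
    have : (i + 1) * (p + 1) = i + (i * p + p + 1) := by ring
    omega
  rw [IsIdempotentElem, h1, ← pow_add, hper (i * p + p + 1) (i + 1)]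
  congr 1; ring

theorem eq_pow_mul_mul_pow {M : Type*} [Monoid M] {r x y : M} (h : r = x * r * y) (n : ℕ) :
    r = x ^ n * r * y ^ n := by
  induction n with
  | zero => simp
  | succ n ih =>
    calc r = x ^ n * (x * r * y) * y ^ n := by rw [← h, ← ih]
      _ = _ := by rw [pow_succ, pow_succ']; simp only [mul_assoc]

variable {M : Type*} [Monoid M] [Finite M]

/-- If `r = x r y`, then some idempotent power of `x` fixes `r`. -/
theorem exists_pow_mul_eq {r x y : M} (h : r = x * r * y) :
    ∃ n : ℕ, IsIdempotentElem (x ^ (n + 1)) ∧ x ^ (n + 1) * r = r := by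
  obtain ⟨n, hn⟩ := exists_isIdempotentElem_pow x
  refine ⟨n, hn, ?_⟩
  have h1 := eq_pow_mul_mul_pow h (n + 1)
  rw [h1, ← mul_assoc, ← mul_assoc, hn]

theorem exists_mul_pow_eq {r x y : M} (h : r = x * r * y) :
    ∃ n : ℕ, IsIdempotentElem (y ^ (n + 1)) ∧ r * y ^ (n + 1) = r := by
  obtain ⟨n, hn⟩ := exists_isIdempotentElem_pow y
  refine ⟨n, hn, ?_⟩
  have h1 := eq_pow_mul_mul_pow h (n + 1)
  rw [h1, mul_assoc, hn]

/-- Some idempotent power `g` of `xe` fixes `r`. As `ge = g` and idempotents commute, `er = egr = gr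
= r`. -/
theorem eq_idempotent_mul_of_eq [CommutingIdempotents M] {e r x y : M} (he : IsIdempotentElem e)
    (h : r = x * (e * r) * y) : e * r = r := by
  obtain ⟨n, hn, hr⟩ := exists_pow_mul_eq (r := r) (x := x * e) (y := y)
    (by rw [mul_assoc x e r, ← h])
  have hg : (x * e) ^ (n + 1) * e = (x * e) ^ (n + 1) := by
    rw [pow_succ, mul_assoc, mul_assoc x e e, he]
  rw [← hr, ← mul_assoc, CommutingIdempotents.comm _ _ he hn, hg]

/-- A power `f` of `ty` satisfies `sf = s`, and a power `e` of `x's` satisfies `et = t`. Since `f`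
begins with `t` and `e` ends in `s`, `f = ef = e`; thus `se = s` with `e` ending in `s`, which makes
`s` regular. -/
theorem exists_mul_mul_eq_of_mul_eq [CommutingIdempotents M] {s t x y x' y' : M}
    (hs : s = x * (s * t) * y) (ht : t = x' * (s * t) * y') :
    ∃ q, s * q * s = s := by
  obtain ⟨n, hf, hsf⟩ := exists_mul_pow_eq (r := s) (x := x) (y := t * y)
    (by rw [← mul_assoc, mul_assoc x, ← hs])
  obtain ⟨m, he, het⟩ := exists_pow_mul_eq (r := t) (x := x' * s) (y := y')
    (by rw [mul_assoc x' s t, ← ht])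
  have hef : (x' * s) ^ (m + 1) * (t * y) ^ (n + 1) = (t * y) ^ (n + 1) := by
    rw [pow_succ' (t * y), mul_assoc t, ← mul_assoc _ t, het]
  have hef' : (x' * s) ^ (m + 1) * (t * y) ^ (n + 1) = (x' * s) ^ (m + 1) := by
    rw [pow_succ (x' * s), mul_assoc, mul_assoc x', hsf]
  have heq : (x' * s) ^ (m + 1) = (t * y) ^ (n + 1) := hef'.symm.trans hef
  refine ⟨(x' * s) ^ m * x', ?_⟩
  rw [mul_assoc, mul_assoc _ x', ← pow_succ, heq, hsf]

end FiniteSemigroup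

/-! ### Principal ideals and regularity. -/

section PrincipalIdeal

variable {S : Type*} [Semigroup S]

instance [CommutingIdempotents S] : CommutingIdempotents (WithOne S) where
  comm e f he hf := by
    induction e with
    | one => simp
    | coe e =>
      induction f with
      | one => simp
      | coe f =>
        rw [← WithOne.coe_mul, ← WithOne.coe_mul,
          CommutingIdempotents.comm e f (WithOne.coe_injective he) (WithOne.coe_injective hf)]

instance [Finite S] : Finite (WithOne S) := inferInstanceAs (Finite (Option S))

/-- The principal two-sided ideal generated by `s`, in the monoid obtained by adjoining an
identity. -/
def principalIdeal (s : S) : Set (WithOne S) :=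
  {m | ∃ x y : WithOne S, m = x * s * y}

theorem mem_principalIdeal_self (s : S) : (s : WithOne S) ∈ principalIdeal s :=
  ⟨1, 1, by simp⟩

theorem principalIdeal_mono {s t : S} (h : (s : WithOne S) ∈ principalIdeal t) :
    principalIdeal s ⊆ principalIdeal t := by
  rintro _ ⟨x, y, rfl⟩
  obtain ⟨x', y', h⟩ := h
  exact ⟨x * x', y' * y, by rw [h]; simp only [mul_assoc]⟩

theorem mul_mem_principalIdeal_left (s t : S) :
    ((s * t : S) : WithOne S) ∈ principalIdeal s := ⟨1, t, by simp⟩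

theorem mul_mem_principalIdeal_right (s t : S) :
    ((s * t : S) : WithOne S) ∈ principalIdeal t := ⟨s, 1, by simp⟩

variable [Finite S]

theorem ncard_principalIdeal_le {s t : S} (h : (s : WithOne S) ∈ principalIdeal t) :
    (principalIdeal s).ncard ≤ (principalIdeal t).ncard :=
  Set.ncard_le_ncard (principalIdeal_mono h) (Set.toFinite _)

/-- Nested finite ideals of equal size coincide, so the size can serve as a numerical rank for
inclusion of principal ideals. -/
theorem mem_principalIdeal_of_ncard_le {s t : S} (h : (s : WithOne S) ∈ principalIdeal t)
    (hc : (principalIdeal t).ncard ≤ (principalIdeal s).ncard) :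
    (t : WithOne S) ∈ principalIdeal s := by
  rw [Set.eq_of_subset_of_ncard_le (principalIdeal_mono h) hc (Set.toFinite _)]
  exact mem_principalIdeal_self t

variable [CommutingIdempotents S]

omit [Finite S] in
theorem mem_regularElements_of_coe_mul {s : S} {q : WithOne S}
    (h : (s : WithOne S) * q * s = s) : s ∈ regularElements S := by
  induction q with
  | one =>
    rw [mul_one, ← WithOne.coe_mul, WithOne.coe_inj] at h
    exact ⟨s, by rw [h, h], by rw [h, h]⟩
  | coe q =>
    rw [← WithOne.coe_mul, ← WithOne.coe_mul, WithOne.coe_inj] at h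
    refine ⟨q * s * q, ?_, ?_⟩
    · calc s * (q * s * q) * s = (s * q * s) * q * s := by simp only [mul_assoc]
        _ = s := by rw [h, h]
    · calc q * s * q * s * (q * s * q) = q * ((s * q * s) * q * s) * q := by
            simp only [mul_assoc]
        _ = q * s * q := by rw [h, h]

/-- If the product of two elements generates ideals no smaller than theirs, both are regular. -/
theorem mem_regularElements_of_ncard_le {s t : S}
    (hs : (principalIdeal s).ncard ≤ (principalIdeal (s * t)).ncard)
    (ht : (principalIdeal t).ncard ≤ (principalIdeal (s * t)).ncard) :
    s ∈ regularElements S := by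
  obtain ⟨x, y, h1⟩ := mem_principalIdeal_of_ncard_le (mul_mem_principalIdeal_left s t) hs
  obtain ⟨x', y', h2⟩ := mem_principalIdeal_of_ncard_le (mul_mem_principalIdeal_right s t) ht
  rw [WithOne.coe_mul] at h1 h2
  obtain ⟨q, hq⟩ := exists_mul_mul_eq_of_mul_eq h1 h2
  exact mem_regularElements_of_coe_mul hq

omit [Finite S] in
theorem coe_mem_principalIdeal_of_mem_downSet {u : regularElements S} {r : S}
    (h : u ∈ downSet r) : ((u : S) : WithOne S) ∈ principalIdeal r := by
  rw [← mem_downSet.1 h]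
  exact mul_mem_principalIdeal_right _ _

/-- Here `u = er` with `e = uu⁻¹` generates the same ideal as `r`, so `eq_idempotent_mul_of_eq`
gives `er = r`. This makes `ν` triangular with respect to ideal size. -/
theorem eq_of_mem_downSet_of_ncard_le {u : regularElements S} {r : S} (h : u ∈ downSet r)
    (hc : (principalIdeal r).ncard ≤ (principalIdeal (u : S)).ncard) : r = u := by
  obtain ⟨x, y, h1⟩ :=
    mem_principalIdeal_of_ncard_le (coe_mem_principalIdeal_of_mem_downSet h) hc
  have h2 := mem_downSet.1 h
  rw [← h2, WithOne.coe_mul] at h1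
  have h3 := eq_idempotent_mul_of_eq (e := (((u * inv u : regularElements S) : S) : WithOne S))
    (congrArg WithOne.coe (idem_coe (idem_mul_inv u))) h1
  rw [← WithOne.coe_mul, WithOne.coe_inj, h2] at h3
  exact h3.symm

end PrincipalIdeal

/-! ### The kernel of `ν` is nil. -/

section NilpotentKernel

variable {S : Type*} [Semigroup S] [CommutingIdempotents S] [Finite S] (K : Type*) [Field K]

instance : FiniteDimensional K K[S] :=
  Module.Basis.finiteDimensional_of_finite (MonoidAlgebra.basis S K)

theorem span_groupoidBasisElement :
    Submodule.span K (Set.range (groupoidBasisElement (S := S) K)) = ⊤ := by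
  rw [eq_top_iff, ← (MonoidAlgebra.basis (regularElements S) K).span_eq, Submodule.span_le]
  rintro _ ⟨s, rfl⟩
  have h : MonoidAlgebra.basis (regularElements S) K s = MonoidAlgebra.single s 1 := rfl
  rw [h, ← sum_groupoidBasisElement]
  exact Submodule.sum_mem _ fun t _ => Submodule.subset_span ⟨t, rfl⟩

theorem linearIndependent_groupoidBasisElement :
    LinearIndependent K (groupoidBasisElement (S := S) K) := by
  have := Fintype.ofFinite (regularElements S)
  refine linearIndependent_of_top_le_span_of_card_eq_finrank (span_groupoidBasisElement K).ge ?_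
  rw [Module.finrank_eq_card_basis (MonoidAlgebra.basis (regularElements S) K)]

variable (S) in
/-- The basis of `K R(S)` formed by the elements `⌊s⌋`. -/
noncomputable def groupoidBasis : Module.Basis (regularElements S) K K[regularElements S] :=
  Module.Basis.mk (linearIndependent_groupoidBasisElement K) (span_groupoidBasisElement K).ge

theorem groupoidBasis_apply (s : regularElements S) :
    groupoidBasis S K s = groupoidBasisElement K s := by
  simp [groupoidBasis]

theorem groupoidBasis_repr_nu_single (u : regularElements S) (r : S) (a : K)
    [Decidable (u ∈ downSet r)] :
    (groupoidBasis S K).repr (nu S K (MonoidAlgebra.single r a)) u =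
      if u ∈ downSet r then a else 0 := by
  classical
  rw [nu_single, map_smul, map_sum]
  simp only [← groupoidBasis_apply, Module.Basis.repr_self]
  rw [Finsupp.smul_apply, Finsupp.finsetSum_apply]
  simp [Finsupp.single_apply]

variable {K}

/-- If no element of the support of `x ∈ ker ν` generates an ideal larger than that of a regular
element `u`, then `u` is not in this support. -/
theorem coeff_eq_zero_of_nu_eq_zero {x : K[S]} (hx : nu S K x = 0) (u : regularElements S)
    (h : ∀ r, x.coeff r ≠ 0 → (principalIdeal r).ncard ≤ (principalIdeal (u : S)).ncard) :
    x.coeff u = 0 := by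
  classical
  have h1 : (groupoidBasis S K).repr (nu S K (x.coeff.sum MonoidAlgebra.single)) u = 0 := by
    rw [MonoidAlgebra.sum_coeff_single, hx, map_zero, Finsupp.zero_apply]
  rw [Finsupp.sum, map_sum, map_sum, Finsupp.finsetSum_apply] at h1
  simp only [groupoidBasis_repr_nu_single] at h1
  -- The coordinate of `ν(x)` at `⌊u⌋` sums the coefficients of all `r` with `u ∈ r↓`; the size
  -- bound leaves only `r = u`.
  rw [Finset.sum_congr rfl (g := fun r => if r = (u : S) then x.coeff r else 0),
    Finset.sum_ite_eq'] at h1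
  · by_contra h0
    rw [if_pos (Finsupp.mem_support_iff.2 h0)] at h1
    exact h0 h1
  · intro r hr
    refine if_congr ⟨fun hu => ?_, ?_⟩ rfl rfl
    · exact eq_of_mem_downSet_of_ncard_le hu (h r (Finsupp.mem_support_iff.1 hr))
    · rintro rfl
      exact mem_downSet_coe.2 le_rfl

theorem exists_mul_of_coeff_mul_ne_zero {T : Type*} [Mul T] {x y : K[T]} {s : T}
    (h : (x * y).coeff s ≠ 0) : ∃ a b, x.coeff a ≠ 0 ∧ y.coeff b ≠ 0 ∧ a * b = s := by
  classical
  contrapose! h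
  rw [MonoidAlgebra.coeff_mul]
  refine Finset.sum_eq_zero fun a ha => Finset.sum_eq_zero fun b hb => if_neg ?_
  exact h a b (Finsupp.mem_support_iff.1 ha) (Finsupp.mem_support_iff.1 hb)

theorem isNilpotent_of_nu_eq_zero {x : K[S]} (hx : nu S K x = 0) :
    IsNilpotent (x : Unitization K K[S]) := by
  -- Induction on a bound for the ideal sizes over the support; replacing `x` by `x * x` lowers the
  -- bound by one.
  have key : ∀ (n : ℕ) (x : K[S]), nu S K x = 0 →
      (∀ s, x.coeff s ≠ 0 → (principalIdeal s).ncard ≤ n) →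
      IsNilpotent (x : Unitization K K[S]) := by
    intro n
    induction n with
    | zero =>
      intro x _ h
      have h0 : x = 0 := by
        ext s
        by_contra hs
        have h1 := h s hs
        rw [Nat.le_zero, Set.ncard_eq_zero (Set.toFinite _)] at h1
        exact Set.notMem_empty _ (h1 ▸ mem_principalIdeal_self s)
      rw [h0, Unitization.inr_zero]
      exact IsNilpotent.zero
    | succ n ih =>
      intro x hx h
      rw [← IsNilpotent.pow_iff_pos (n := 2) two_ne_zero, sq, ← Unitization.inr_mul]
      refine ih (x * x) (by rw [nu_mul, hx, zero_mul]) fun s hs => ?_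
      obtain ⟨a, b, ha, hb, rfl⟩ := exists_mul_of_coeff_mul_ne_zero hs
      by_contra! hlt
      -- If `ab` exceeds the bound `n`, its ideal is at least as large as those of `a` and `b`, so
      -- `a` is regular of maximal ideal size, contradicting `ha`.
      have hreg : a ∈ regularElements S :=
        mem_regularElements_of_ncard_le ((h a ha).trans hlt) ((h b hb).trans hlt)
      refine ha (coeff_eq_zero_of_nu_eq_zero hx ⟨a, hreg⟩ fun r hr => (h r hr).trans ?_)
      exact Nat.succ_le_of_lt (hlt.trans_le
        (ncard_principalIdeal_le (mul_mem_principalIdeal_left a b)))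
  exact key (Nat.card (WithOne S)) x hx fun s _ => by
    rw [← Set.ncard_univ]
    exact Set.ncard_le_ncard (Set.subset_univ _)

theorem nuHom_surjective : Function.Surjective (nuHom S K) :=
  fun x => ⟨inclusion S K x, nu_inclusion K x⟩

end NilpotentKernel

/-! ### Traces, vanishing of the radical of `K R(S)`, and a basis of the kernel. -/

section Semisimple

variable {S : Type*} [Semigroup S] [CommutingIdempotents S]

theorem maximalSubgroup_coe (e : regularElements S) :
    maximalSubgroup (e : S) = Subtype.val '' {t | t * inv t = e ∧ inv t * t = e} := by
  ext s
  constructor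
  · rintro ⟨⟨h1, h2⟩, t, ⟨h3, h4⟩, h5, h6⟩
    have h : AreInverses s t := ⟨by rw [h5, h1], by rw [h6, h3]⟩
    have hinv : inv ⟨s, t, h⟩ = ⟨t, s, h.symm⟩ :=
      inv_eq ⟨Subtype.ext h.1, Subtype.ext h.2⟩
    refine ⟨⟨s, t, h⟩, ⟨?_, ?_⟩, rfl⟩ <;> rw [hinv] <;> apply Subtype.ext
    · exact h5
    · exact h6
  · rintro ⟨t, ⟨h1, h2⟩, rfl⟩
    refine ⟨⟨?_, ?_⟩, (inv t : S), ⟨?_, ?_⟩, congrArg Subtype.val h1, congrArg Subtype.val h2⟩ <;>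
      rw [← MulMemClass.coe_mul, Subtype.coe_inj]
    · rw [← h1, mul_inv_mul]
    · rw [← h2, ← mul_assoc, mul_inv_mul]
    · rw [← h2, inv_mul_inv]
    · rw [← h1, ← mul_assoc, inv_mul_inv]

/-- In a groupoid only identities have fixed points under composition: `p = s⁻¹t` satisfies `p =
pp⁻¹p = pqq⁻¹ = qq⁻¹`. Being idempotent, `p = pp⁻¹ = s⁻¹s`, whence `s = t`. -/
theorem eq_of_inv_mul_mul_eq {s t q : regularElements S} (hst : s * inv s = t * inv t)
    (hq : inv (inv s * t) * (inv s * t) = q * inv q) (h : inv s * t * q = q) : s = t := by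
  have hid : IsIdempotentElem (inv s * t) := by
    have h1 : inv s * t = q * inv q := by
      calc inv s * t = inv s * t * (inv (inv s * t) * (inv s * t)) := by
            rw [← mul_assoc, mul_inv_mul]
        _ = q * inv q := by rw [hq, ← mul_assoc, h]
    rw [h1]
    exact idem_mul_inv q
  have h2 : inv s * t = inv s * s := by
    calc inv s * t = inv s * t * inv (inv s * t) := by rw [inv_idem hid, hid]
      _ = inv s * (t * inv t) * s := by rw [inv_mul, regularElements.inv_inv]; simp only [mul_assoc]
      _ = inv s * s := by rw [← hst, ← mul_assoc, inv_mul_inv]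
  calc s = s * (inv s * t) := by rw [h2, ← mul_assoc, mul_inv_mul]
    _ = t := by rw [← mul_assoc, hst, mul_inv_mul]

variable [Finite S] (K : Type*) [Field K]

/-- The trace of left multiplication on the part of `K R(S)` with domain idempotent `e`. -/
noncomputable def domainTrace (e : regularElements S) : K[regularElements S] →ₗ[K] K :=
  LinearMap.trace K K[regularElements S] ∘ₗ
    LinearMap.mulRight K (LinearMap.mulRight K (groupoidBasisElement K e)) ∘ₗ
      LinearMap.mul K K[regularElements S]

theorem domainTrace_apply (e : regularElements S) (b : K[regularElements S]) :
    domainTrace K e b = LinearMap.trace K K[regularElements S]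
      (LinearMap.mulLeft K b * LinearMap.mulRight K (groupoidBasisElement K e)) := rfl

/-- Left multiplication by `b` is nilpotent and commutes with right multiplications, so the
composite is nilpotent and has trace zero. -/
theorem domainTrace_eq_zero_of_isNilpotent (e : regularElements S) {b : K[regularElements S]}
    (hb : IsNilpotent (b : Unitization K K[regularElements S])) : domainTrace K e b = 0 := by
  have h1 : IsNilpotent (LinearMap.mulLeft K b) :=
    isNilpotent_map_of_isNilpotent_inr (NonUnitalAlgHom.lmul K K[regularElements S]) hb
  rw [domainTrace_apply]
  exact (LinearMap.isNilpotent_trace_of_isNilpotent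
    ((LinearMap.commute_mulLeft_right b _).isNilpotent_mul_right h1)).eq_zero

/-- In the groupoid basis the operator sends `⌊q⌋` to `⌊uq⌋` or `0`, so its trace counts the fixed
`q` with domain `e`. -/
theorem domainTrace_groupoidBasisElement {e : regularElements S} (he : IsIdempotentElem e)
    (u : regularElements S) : domainTrace K e (groupoidBasisElement K u) =
      ({q | inv u * u = q * inv q ∧ inv q * q = e ∧ u * q = q}.ncard : K) := by
  classical
  have := Fintype.ofFinite (regularElements S)
  rw [domainTrace_apply, LinearMap.trace_eq_matrix_trace K (groupoidBasis S K), Matrix.trace,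
    Set.ncard_eq_toFinset_card', Finset.card_eq_sum_ones, Nat.cast_sum, Set.toFinset_ofPred,
    Finset.sum_filter]
  refine Finset.sum_congr rfl fun q _ => ?_
  rw [Matrix.diag_apply, LinearMap.toMatrix_apply, groupoidBasis_apply, Module.End.mul_apply,
    LinearMap.mulRight_apply, LinearMap.mulLeft_apply, ← mul_assoc, groupoidBasisElement_mul]
  by_cases h1 : inv u * u = q * inv q
  · rw [if_pos h1, groupoidBasisElement_mul, inv_mul_mul_of_composable h1, inv_idem he, he.eq]
    by_cases h2 : inv q * q = e
    · rw [if_pos h2, ← groupoidBasis_apply, Module.Basis.repr_self, ← h2, mul_assoc u,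
        ← mul_assoc q, mul_inv_mul, Finsupp.single_apply]
      simp [h1]
    · simp [h2]
  · simp [h1]

open Classical in
-- For `s = t` the product is the identity `⌊s⁻¹s⌋`, which fixes the whole group at `s⁻¹s`; for `s ≠
-- t` it is zero or has no fixed points.
theorem domainTrace_inv_mul (s t : regularElements S) :
    domainTrace K (inv s * s) (groupoidBasisElement K (inv s) * groupoidBasisElement K t) =
      if s = t then ((maximalSubgroup ((inv s * s : regularElements S) : S)).ncard : K) else 0 := by
  have he := idem_inv_mul s
  rw [groupoidBasisElement_mul, regularElements.inv_inv]
  split_ifs with h1 h2 h2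
  · subst h2
    rw [domainTrace_groupoidBasisElement K he, maximalSubgroup_coe,
      Set.ncard_image_of_injective _ Subtype.val_injective]
    congr 2
    ext q
    simp only [Set.mem_ofPred_eq, inv_idem he, he.eq]
    constructor
    · rintro ⟨h3, h4, -⟩
      exact ⟨h3.symm, h4⟩
    · rintro ⟨h3, h4⟩
      exact ⟨h3.symm, h4, by rw [← h3, mul_inv_mul]⟩
  · rw [domainTrace_groupoidBasisElement K he]
    have hempty : {q | inv (inv s * t) * (inv s * t) = q * inv q ∧ inv q * q = inv s * s ∧
        inv s * t * q = q} = ∅ := by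
      refine Set.eq_empty_of_forall_notMem ?_
      rintro q ⟨h3, -, h4⟩
      exact h2 (eq_of_inv_mul_mul_eq h1 h3 h4)
    rw [hempty, Set.ncard_empty, Nat.cast_zero]
  · exact absurd (by rw [h2]) h1
  · exact map_zero _

variable {K}

/-- By orthogonality, the trace of `⌊s⁻¹⌋a` is the coordinate of `a` at `⌊s⌋` times a group order.
It vanishes because `⌊s⁻¹⌋a` is nilpotent. -/
theorem eq_zero_of_mem_jacobsonRadical
    (hG : ∀ e : S, IsIdempotentElem e → ((maximalSubgroup e).ncard : K) ≠ 0)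
    {a : K[regularElements S]} (ha : a ∈ jacobsonRadical K[regularElements S]) : a = 0 := by
  classical
  have := Fintype.ofFinite (regularElements S)
  refine (groupoidBasis S K).ext_elem_iff.2 fun s => ?_
  rw [map_zero, Finsupp.zero_apply]
  have h1 := domainTrace_eq_zero_of_isNilpotent K (inv s * s)
    ((mem_jacobsonRadical_iff_isNilpotent K).1 ha (groupoidBasisElement K (inv s)))
  rw [← (groupoidBasis S K).sum_repr a, Finset.mul_sum, map_sum] at h1
  simp only [groupoidBasis_apply, mul_smul_comm, map_smul, domainTrace_inv_mul, smul_eq_mul,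
    mul_ite, mul_zero, Finset.sum_ite_eq, Finset.mem_univ, if_true] at h1
  exact (mul_eq_zero.1 h1).resolve_right (hG _ (idem_coe (idem_inv_mul s)))

omit [CommutingIdempotents S] in
theorem ncard_maximalSubgroup_cast_ne_zero
    (h : ringChar K = 0 ∨ ∀ e : S, IsIdempotentElem e →
      ¬ ringChar K ∣ (maximalSubgroup e).ncard) (e : S) (he : IsIdempotentElem e) :
    ((maximalSubgroup e).ncard : K) ≠ 0 := by
  rw [Ne, ringChar.spec]
  rcases h with h | h
  · rw [h, zero_dvd_iff, Set.ncard_eq_zero (Set.toFinite _)]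
    -- In characteristic zero it is enough that the group contains its identity `e`.
    exact Set.Nonempty.ne_empty ⟨e, ⟨he, he⟩, e, ⟨he, he⟩, he, he⟩
  · exact h e he

theorem ker_nu_eq_jacobsonRadicalSubmodule
    (hG : ∀ e : S, IsIdempotentElem e → ((maximalSubgroup e).ncard : K) ≠ 0) :
    LinearMap.ker (nu S K) = jacobsonRadicalSubmodule K K[S] := by
  ext x
  have h : x ∈ jacobsonRadicalSubmodule K K[S] ↔ nu S K x ∈ jacobsonRadical K[regularElements S] :=
    mem_jacobsonRadical_iff_map_mem (nuHom S K) nuHom_surjective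
      fun x hx => isNilpotent_of_nu_eq_zero hx
  rw [LinearMap.mem_ker, h]
  exact ⟨fun h => h ▸ (jacobsonRadical _).zero_mem, eq_zero_of_mem_jacobsonRadical hG⟩

variable (K) in
theorem nu_sub_inclusion_nu (x : K[S]) : nu S K (x - inclusion S K (nu S K x)) = 0 := by
  rw [map_sub, nu_inclusion, sub_self]

variable (K) in
omit [Finite S] in
theorem coeff_inclusion {s : S} (hs : s ∉ regularElements S) (y : K[regularElements S]) :
    (inclusion S K y).coeff s = 0 := by
  induction y using MonoidAlgebra.induction_linear with
  | zero => simp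
  | add x₁ x₂ h₁ h₂ => rw [map_add, MonoidAlgebra.coeff_add, Finsupp.add_apply, h₁, h₂, add_zero]
  | single r a =>
    classical
    rw [inclusion_single, MonoidAlgebra.coeff_single, Finsupp.single_apply, if_neg]
    rintro rfl
    exact hs r.2

variable (S K) in
/-- The elements `s - ν(s)` of the kernel of `ν`, for `s` not regular. -/
noncomputable def kernelElement (s : {s : S // s ∉ regularElements S}) :
    LinearMap.ker (nu S K) :=
  ⟨MonoidAlgebra.single (s : S) 1 - inclusion S K (nu S K (MonoidAlgebra.single (s : S) 1)),
    nu_sub_inclusion_nu K _⟩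

/-- The subtracted terms are supported on regular elements, so the coefficient at a nonregular `s`
isolates one scalar. -/
theorem linearIndependent_kernelElement : LinearIndependent K (kernelElement S K) := by
  classical
  have := Fintype.ofFinite {s : S // s ∉ regularElements S}
  rw [Fintype.linearIndependent_iff]
  intro g hg s
  have h1 := congrArg (fun x : LinearMap.ker (nu S K) => (x : K[S]).coeff (s : S)) hg
  simp only [Submodule.coe_sum, Submodule.coe_smul, kernelElement, MonoidAlgebra.coeff_sum,
    Finsupp.finsetSum_apply, MonoidAlgebra.coeff_smul, Finsupp.smul_apply, MonoidAlgebra.coeff_sub,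
    Finsupp.sub_apply, coeff_inclusion K s.2, MonoidAlgebra.coeff_single, Finsupp.single_apply,
    sub_zero, smul_eq_mul, mul_ite, mul_one, mul_zero, Subtype.coe_inj, Finset.sum_ite_eq', Finset.mem_univ,
    if_true] at h1
  simpa using h1

theorem sub_inclusion_nu_mem_span (x : K[S]) :
    x - inclusion S K (nu S K x) ∈
      Submodule.span K (Set.range fun s => (kernelElement S K s : K[S])) := by
  induction x using MonoidAlgebra.induction_linear with
  | zero => simp
  | add x₁ x₂ h₁ h₂ =>
    rw [map_add, map_add, add_sub_add_comm]
    exact add_mem h₁ h₂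
  | single s a =>
    by_cases hs : s ∈ regularElements S
    · lift s to regularElements S using hs
      rw [← inclusion_single, nu_inclusion, sub_self]
      exact zero_mem _
    · have h1 : (MonoidAlgebra.single s a : K[S]) = a • MonoidAlgebra.single s 1 := by simp
      rw [h1, map_smul, map_smul, ← smul_sub]
      exact Submodule.smul_mem _ _ (Submodule.subset_span ⟨⟨s, hs⟩, rfl⟩)

/-- An element of the kernel equals `x - ν(x)`, and in this expression the regular part of `x`
cancels. -/
theorem span_kernelElement : ⊤ ≤ Submodule.span K (Set.range (kernelElement S K)) := by
  rintro ⟨x, hx⟩ -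
  have h1 := sub_inclusion_nu_mem_span x
  rw [LinearMap.mem_ker.1 hx, map_zero, sub_zero] at h1
  have h2 : Set.range (fun s => (kernelElement S K s : K[S])) =
      (LinearMap.ker (nu S K)).subtype '' Set.range (kernelElement S K) := by
    rw [← Set.range_comp]; rfl
  rw [h2, Submodule.span_image] at h1
  obtain ⟨y, hy, rfl⟩ := h1
  exact hy

variable (S K) in
/-- The basis of the kernel of `ν` formed by the elements `s - ν(s)`, for `s` not regular. -/
noncomputable def kernelBasis :
    Module.Basis {s : S // s ∉ regularElements S} K (LinearMap.ker (nu S K)) :=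
  Module.Basis.mk linearIndependent_kernelElement span_kernelElement

end Semisimple

open scoped MonoidAlgebra in
theorem corollary8p6 (S : Type*) [Semigroup S] [Finite S] [CommutingIdempotents S]
    (K : Type*) [Field K] :
    ((∀ x y : K[S], nu S K (x * y) = nu S K x * nu S K y) ∧
      (∀ x : K[regularElements S], nu S K (inclusion S K x) = x) ∧
      IsNilpotentSet {x : K[S] | nu S K x = 0} ∧
      ∃ φ : RadicalQuotient K[S] →ₙₐ[K] RadicalQuotient K[regularElements S],
        Function.Bijective φ ∧
          ∀ x : K[S], φ (RadicalQuotient.mk x) = RadicalQuotient.mk (nu S K x)) ∧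
    ((ringChar K = 0 ∨ ∀ e : S, IsIdempotentElem e → ¬ ringChar K ∣ (maximalSubgroup e).ncard) →
      LinearMap.ker (nu S K) = jacobsonRadicalSubmodule K K[S] ∧
      Module.finrank K (jacobsonRadicalSubmodule K K[S]) =
        {s : S | s ∉ regularElements S}.ncard ∧
      ∃ b : Module.Basis {s : S // s ∉ regularElements S} K (jacobsonRadicalSubmodule K K[S]),
        ∀ s, (b s : K[S]) = MonoidAlgebra.single (s : S) 1 -
          inclusion S K (nu S K (MonoidAlgebra.single (s : S) 1))) := by
  refine ⟨⟨nu_mul K, nu_inclusion K, ?_, ?_⟩, fun h => ?_⟩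
  · refine isNilpotentSet_of_subset_jacobsonRadical K fun x hx => ?_
    rw [mem_jacobsonRadical_iff_isNilpotent K]
    refine fun b => isNilpotent_of_nu_eq_zero ?_
    rw [nu_mul, show nu S K x = 0 from hx, mul_zero]
  · exact exists_radicalQuotient_bijective (nuHom S K) nuHom_surjective
      fun x hx => isNilpotent_of_nu_eq_zero hx
  · have hker := ker_nu_eq_jacobsonRadicalSubmodule (ncard_maximalSubgroup_cast_ne_zero h)
    rw [← hker]
    refine ⟨rfl, ?_, kernelBasis S K, fun s => by simp [kernelBasis, kernelElement]⟩
    rw [Module.finrank_eq_nat_card_basis (kernelBasis S K)]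
    rfl
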